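/- **Discard expansion.** Consider the Cramér–Lundberg risk model with premium rate $1$, Poisson claim arrivals of rate $\lambda>0$ and, independently, i.i.d. claim sizes with distribution $G_\epsilon$ which, with $\epsilon\in[0,1]$, is with probability $1-\epsilon$ the phase-type law of $B$ and with probability $\epsilon$ the heavy-tailed law of $C$ (i.e. $C\ge 0$ and $\mathbb E e^{sC}=\infty$ for all $s>0$), both with finite mean. Put $\delta=\lambda\,\mathbb E B$, $\theta=\lambda\,\mathbb E C$, $\rho_\epsilon=(1-\epsilon)\delta+\epsilon\theta$. For $u\ge 0$ let $\psi_\epsilon(u)=\mathbb P(\sup_{t\ge 0}S_\epsilon(t)>u)$, where $S_\epsilon(t)$ is the total claim amount up to time $t$ minus $t$. Let $M^\bullet_\epsilon$ be the supremum of the claim surplus process in the same model with claim size distribution $(1-\epsilon)\mathbb P(B\le x)+\epsilon$, $x\ge 0$ (heavy-tailed claims discarded), and $\psi^\bullet_\epsilon(u)=\mathbb P(M^\bullet_\epsilon>u)$. Assume that the discard model is stable, $(1-\epsilon)\delta<1$ (this is implied by $\rho_\epsilon<1$). Let $M^\bullet_{\epsilon,i}$, $i\ge 0$, be copies of $M^\bullet_\epsilon$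 and $C^e_i$, $i\ge1$, random variables with the stationary excess distribution of $C$, of density $\mathbb P(C>t)/\mathbb E C$ on $(0,\infty)$, all independent, and put $$L_{\epsilon,n}(u)=\mathbb P(M^\bullet_{\epsilon,0}+\dots+M^\bullet_{\epsilon,n}+C^e_1+\dots+C^e_n>u),$$ so that $L_{\epsilon,0}=\psi^\bullet_\epsilon$. Consider the discard series $$\sum_{n=1}^\infty\Big(\frac{\epsilon\theta}{1-\delta+\epsilon\delta}\Big)^n\big(L_{\epsilon,n}(u)-L_{\epsilon,n-1}(u)\big).\qquad(*)$$ Then: 1. If the model is stable, $\rho_\epsilon<1$, then for every $u\ge 0$ the series $(*)$ converges and $$\psi_\epsilon(u)=\psi^\bullet_\epsilon(u)+\sum_{n=1}^\infty\Big(\frac{\epsilon\theta}{1-\delta+\epsilon\delta}\Big)^n\big(L_{\epsilon,n}(u)-L_{\epsilon,n-1}(u)\big);$$ in this setting a necessary and sufficient condition for the convergence of $(*)$ for all $u\ge 0$ is $|\epsilon\theta|<|1-\delta+\epsilon\delta|$ (both hold). 2. If only $\rho_\epsilon\ne 1$ is assumed, then $(*)$ converges to $\psi_\epsilon(u)-\psi^\bullet_\epsilon(u)$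 for all $u\ge 0$ if and only if $|\epsilon\theta|<|1-\delta+\epsilon\delta|$. 3. With no assumption on $\rho_\epsilon$, the series $(*)$ converges uniformly in $u\ge 0$ if and only if $|\epsilon\theta|<|1-\delta+\epsilon\delta|$. -/

import Mathlib

open MeasureTheory ProbabilityTheory Filter
open scoped Matrix Topology

noncomputable section

/-- A phase-type distribution on `[0,∞)`: the law of the absorption time of a finite-state
continuous-time Markov chain with initial (sub)probability vector `α` on the transient states and
subintensity matrix `T` (the missing mass of `α` is an atom at zero). -/
def IsPhaseType (F : Measure ℝ) : Prop :=
  F (Set.Iio 0) = 0 ∧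
  ∃ (p : ℕ) (α : Fin p → ℝ) (T : Matrix (Fin p) (Fin p) ℝ),
    (∀ i, 0 ≤ α i) ∧ ∑ i, α i ≤ 1 ∧
    (∀ i j, i ≠ j → 0 ≤ T i j) ∧ (∀ i, ∑ j, T i j ≤ 0) ∧ IsUnit T.det ∧
    ∀ x : ℝ, 0 ≤ x → F.real (Set.Ioi x) = α ⬝ᵥ (NormedSpace.exp (x • T) *ᵥ (fun _ => 1))

/-- A heavy-tailed distribution on `[0,∞)`: no exponential moment of positive order is finite. -/
def IsHeavyTailed (F : Measure ℝ) : Prop :=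
  F (Set.Iio 0) = 0 ∧ ∀ s : ℝ, 0 < s → ∫⁻ x, ENNReal.ofReal (Real.exp (s * x)) ∂F = ⊤

/-- Claim size distribution that is `F` with probability `1 - ε` and `H` with probability `ε`. -/
def mixtureLaw (ε : ℝ) (F H : Measure ℝ) : Measure ℝ :=
  ENNReal.ofReal (1 - ε) • F + ENNReal.ofReal ε • H

/-- The claim size distribution `x ↦ (1 - ε) F(x) + ε`, `x ≥ 0`, obtained by discarding the
second component of the mixture: its claims are replaced by claims of size zero. -/
def discardLaw (ε : ℝ) (F : Measure ℝ) : Measure ℝ :=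
  mixtureLaw ε F (Measure.dirac 0)

/-- The stationary excess distribution: density `t ↦ (1 - F(t)) / mean F` on `(0,∞)`. -/
def excessLaw (F : Measure ℝ) : Measure ℝ :=
  (volume.restrict (Set.Ioi 0)).withDensity
    (fun t => ENNReal.ofReal (F.real (Set.Ioi t) / ∫ x, x ∂F))

/-- Input of the classical Cramér-Lundberg model: i.i.d. exponential interarrival times `τ` with
rate `lam` (so that claims arrive according to a Poisson process with rate `lam`) and, independently
of them, i.i.d. claim sizes `X` with distribution `G`. -/
structure IsCramerLundberg {Ω : Type*} [MeasurableSpace Ω] (P : Measure Ω)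
    (lam : ℝ) (G : Measure ℝ) (τ X : ℕ → Ω → ℝ) : Prop where
  law_interarrival : ∀ i, HasLaw (τ i) (expMeasure lam) P
  law_claim : ∀ i, HasLaw (X i) G P
  indep : iIndepFun (Sum.elim τ X) P

/-- The number of claims that have arrived up to time `t`: the `n`-th claim, `n = 0, 1, …`, arrives
at time `τ 0 + ⋯ + τ n`. -/
def claimCount {Ω : Type*} (τ : ℕ → Ω → ℝ) (t : ℝ) (ω : Ω) : ℕ :=
  Set.ncard {n : ℕ | ∑ i ∈ Finset.range (n + 1), τ i ω ≤ t}

/-- The claim surplus process `∑_{i < N(t)} X i - t` (premium rate 1). -/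
def claimSurplus {Ω : Type*} (τ X : ℕ → Ω → ℝ) (t : ℝ) (ω : Ω) : ℝ :=
  ∑ i ∈ Finset.range (claimCount τ t ω), X i ω - t

/-- The supremum over `t ≥ 0` of the claim surplus process, possibly `+∞`. -/
def surplusSup {Ω : Type*} (τ X : ℕ → Ω → ℝ) (ω : Ω) : EReal :=
  ⨆ (t : ℝ) (_ : 0 ≤ t), (claimSurplus τ X t ω : EReal)

/-- The probability of ultimate ruin with initial capital `u`. -/
def ruinProb {Ω : Type*} [MeasurableSpace Ω] (P : Measure Ω) (τ X : ℕ → Ω → ℝ) (u : ℝ) : ℝ :=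
  P.real {ω | (u : EReal) < surplusSup τ X ω}

/-- `L_n(u) = P(M_0 + ⋯ + M_n + C_1 + ⋯ + C_n > u)`. -/
def tailL {Ω : Type*} [MeasurableSpace Ω] (P : Measure Ω) (M : ℕ → Ω → EReal) (C : ℕ → Ω → ℝ)
    (n : ℕ) (u : ℝ) : ℝ :=
  P.real {ω | (u : EReal) <
    ∑ i ∈ Finset.range (n + 1), M i ω + ∑ i ∈ Finset.range n, (C i ω : EReal)}

/-- The term of index `n + 1` (`n = 0, 1, …`) of the discard series with ratio `r`. -/
def discardTerm {Ω : Type*} [MeasurableSpace Ω] (P : Measure Ω) (M : ℕ → Ω → EReal)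
    (C : ℕ → Ω → ℝ) (r : ℝ) (n : ℕ) (u : ℝ) : ℝ :=
  r ^ (n + 1) * (tailL P M C (n + 1) u - tailL P M C n u)

end

/-!
Write `d = 1 - (1 - ε) δ`, which is positive because the discard model is stable. The ratio of the
series is `r = ε θ / d ≥ 0`, and both `|ε θ| < |1 - δ + ε δ|` and stability of the mixture model
amount to `r < 1`.

*The expansion.* Between claims the surplus process decreases, so its supremum is that of a random
walk with steps `X i - τ i` (`surplusSup_eq_walkSup`). If the steps have negative mean, the supremum
`M` is finite by the strong law of large numbers and satisfies Lindley's equation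
`M ~ max 0 (M + X - τ)` with independent `M`, `X`, `τ` on the right (`lindley`). As `τ` is
exponential, taking characteristic functions turns this into a linear equation for the one of `M`,
whose solution is the Pollaczek–Khinchine formula (`IsCramerLundberg.charFun_surplusSup`). Writing
the formula for the mixture and for the discard model and eliminating the light-tailed claims by
means of `charFun_excessLaw` gives
`φ (1 - r φ• κ) = (1 - r) φ•`, where `φ`, `φ•`, `κ` are the characteristic functions of the two
suprema and of the excess distribution of `C` (`charFun_mixture_of_discard`). For `r < 1` this says
that the law of the supremum in the mixture model is the geometric mixture, with weights
`(1 - r) rⁿ`, of the laws of `M•₀ + ⋯ + M•ₙ + Cᵉ₁ + ⋯ + Cᵉₙ` (`hasSum_tail`), and summation by parts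
yields the discard series (`hasSum_pow_mul_sub`).

*Divergence.* Let `L n u` be the tail `tailL` of these sums. For fixed `u` it increases to `1` in `n`
(`monotone_tail`, `tendsto_tail`) and tends to `0` as `u → ∞` for fixed `n` (`tendsto_tail_atTop`).
If `r ≥ 1`, a block of the series from `N` to `K` is at least `L K u - L N u`, hence not uniformly
small (`exists_tendstoUniformlyOn_iff`). If the mixture model has `ρ > 1`, then ruin is certain,
while `r > 1` forces the sum of the series to exceed `1 - L 0 u` (`not_hasSum_of_one_lt`).
-/

/-! ### The supremum of the surplus process as the supremum of a random walk -/

section Walk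

/-- The supremum of the partial sums `x 0 + ⋯ + x (n - 1)`, `n = 0, 1, …`, of a real sequence. -/
noncomputable def walkSup (x : ℕ → ℝ) : EReal :=
  ⨆ n : ℕ, ((∑ i ∈ Finset.range n, x i : ℝ) : EReal)

lemma walkSup_nonneg (x : ℕ → ℝ) : 0 ≤ walkSup x := by
  refine le_trans ?_ (le_iSup _ 0)
  simp

lemma measurable_walkSup : Measurable walkSup := by
  unfold walkSup
  refine Measurable.iSup fun n => ?_
  exact measurable_coe_real_ereal.comp (by fun_prop)

/-- The supremum is zero or is attained after the first step. -/
lemma walkSup_eq_max (x : ℕ → ℝ) :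
    walkSup x = max 0 ((x 0 : EReal) + walkSup fun i => x (i + 1)) := by
  unfold walkSup
  rw [← sup_iSup_nat_succ]
  congr 1
  simp only [Finset.sum_range_succ' (fun i => x i)]
  apply le_antisymm
  · refine iSup_le fun n => ?_
    rw [add_comm, EReal.coe_add]
    exact add_le_add le_rfl
      (le_iSup (fun n : ℕ => ((∑ i ∈ Finset.range n, x (i + 1) : ℝ) : EReal)) n)
  · rw [add_comm, ← EReal.le_sub_iff_add_le (by simp) (by simp)]
    refine iSup_le fun n => ?_
    rw [EReal.le_sub_iff_add_le (by simp) (by simp), ← EReal.coe_add]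
    exact le_iSup (fun n : ℕ => ((∑ i ∈ Finset.range n, x (i + 1) + x 0 : ℝ) : EReal)) n

lemma toReal_walkSup_eq_max {x : ℕ → ℝ} (hx : walkSup (fun i => x (i + 1)) < ⊤) :
    (walkSup x).toReal = max 0 ((walkSup fun i => x (i + 1)).toReal + x 0) := by
  rw [walkSup_eq_max]
  have h0 := walkSup_nonneg fun i => x (i + 1)
  lift walkSup (fun i => x (i + 1)) to ℝ using ⟨hx.ne, (lt_of_lt_of_le (by simp) h0).ne'⟩ with w
  rw [← EReal.coe_add, ← EReal.coe_zero, ← EReal.coe_strictMono.monotone.map_max, EReal.toReal_coe,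
    EReal.toReal_coe, add_comm]

variable {Ω : Type*}

lemma claimCount_eq {τ : ℕ → Ω → ℝ} {ω : Ω} (hτ : ∀ i, 0 ≤ τ i ω) {N : ℕ} {t : ℝ}
    (h1 : ∑ i ∈ Finset.range N, τ i ω ≤ t) (h2 : t < ∑ i ∈ Finset.range (N + 1), τ i ω) :
    claimCount τ t ω = N := by
  have hmono : Monotone fun n => ∑ i ∈ Finset.range n, τ i ω :=
    monotone_nat_of_le_succ fun n => by
      rw [Finset.sum_range_succ]; exact le_add_of_nonneg_right (hτ n)
  have : {n : ℕ | ∑ i ∈ Finset.range (n + 1), τ i ω ≤ t} = (Finset.range N : Set ℕ) := by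
    ext n
    simp only [Set.mem_ofPred_eq, Finset.coe_range, Set.mem_Iio]
    constructor
    · intro h
      by_contra hn
      have := hmono (show N + 1 ≤ n + 1 by omega)
      simp only at this
      linarith
    · intro h
      exact (hmono (show n + 1 ≤ N by omega)).trans h1
  rw [claimCount, this, Set.ncard_coe_finset, Finset.card_range]

/-- Between claims the surplus process decreases, so that its supremum is the supremum of the random
walk observed at the claim epochs. -/
lemma surplusSup_eq_walkSup {τ X : ℕ → Ω → ℝ} {ω : Ω} (hτ : ∀ i, 0 < τ i ω)
    (htop : Tendsto (fun n => ∑ i ∈ Finset.range n, τ i ω) atTop atTop) :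
    surplusSup τ X ω = walkSup fun i => X i ω - τ i ω := by
  apply le_antisymm
  · refine iSup₂_le fun t ht => ?_
    have hex : ∃ n, t < ∑ i ∈ Finset.range n, τ i ω :=
      (htop.eventually_gt_atTop t).exists
    classical
    obtain ⟨N, hN⟩ : ∃ N, Nat.find hex = N + 1 := by
      refine Nat.exists_eq_succ_of_ne_zero fun h0 => ?_
      have := Nat.find_spec hex
      rw [h0] at this
      simp at this
      linarith
    have h2 := Nat.find_spec hex
    rw [hN] at h2
    have h1 : ∑ i ∈ Finset.range N, τ i ω ≤ t := by
      have := Nat.find_min hex (m := N) (by omega)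
      linarith
    refine le_trans ?_ (le_iSup _ N)
    rw [claimSurplus, claimCount_eq (fun i => (hτ i).le) h1 h2, EReal.coe_le_coe_iff,
      Finset.sum_sub_distrib]
    linarith
  · refine iSup_le fun N => ?_
    have h0 : 0 ≤ ∑ i ∈ Finset.range N, τ i ω := Finset.sum_nonneg fun i _ => (hτ i).le
    refine le_trans ?_ (le_iSup₂ (∑ i ∈ Finset.range N, τ i ω) h0)
    rw [claimSurplus, claimCount_eq (fun i => (hτ i).le) le_rfl
      (by rw [Finset.sum_range_succ]; linarith [hτ N]), Finset.sum_sub_distrib]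

variable [MeasurableSpace Ω] {P : Measure Ω}

/-- The steps of the random walk are independent and identically distributed. -/
lemma iIndepFun_sub {τ X : ℕ → Ω → ℝ} (h : iIndepFun (Sum.elim τ X) P)
    (hτ : ∀ i, AEMeasurable (τ i) P) (hX : ∀ i, AEMeasurable (X i) P) :
    iIndepFun (fun i ω => X i ω - τ i ω) P := by
  have := h.isProbabilityMeasure
  -- reindexing by pairs (claim, type of variable) and currying the product measure
  let g : ((_ : ℕ) × Bool) → ℕ ⊕ ℕ := fun p => cond p.2 (Sum.inl p.1) (Sum.inr p.1)
  have hg : g.Injective := by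
    rintro ⟨i, b⟩ ⟨j, c⟩ h
    cases b <;> cases c <;> simp_all [g]
  let Z : ℕ → Bool → Ω → ℝ := fun i b => cond b (τ i) (X i)
  have hZ : ∀ i b, AEMeasurable (Z i b) P := by rintro i (_ | _) <;> simp [Z, hτ, hX]
  have hind : iIndepFun (fun (p : (_ : ℕ) × Bool) => Z p.1 p.2) P := by
    convert h.precomp hg using 2 with p
    rcases p with ⟨i, _ | _⟩ <;> rfl
  have hpr : ∀ i b, IsProbabilityMeasure (P.map (Z i b)) := fun i b =>
    Measure.isProbabilityMeasure_map (hZ i b)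
  have hpair : iIndepFun (fun i ω b => Z i b ω) P := by
    have hm : ∀ i, AEMeasurable (fun ω b => Z i b ω) P := fun i => aemeasurable_pi_iff.2 (hZ i)
    rw [iIndepFun_iff_map_fun_eq_infinitePi_map₀' hm]
    have e := hind.map_fun_eq_infinitePi_map₀' (fun p : (_ : ℕ) × Bool => hZ p.1 p.2)
    have e2 := Measure.infinitePi_map_piCurry (ι := ℕ) (κ := fun _ => Bool)
      (X := fun _ _ => ℝ) (fun (i : ℕ) (b : Bool) => P.map (Z i b))
    rw [← e, AEMeasurable.map_map_of_aemeasurable (by fun_prop)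
      (aemeasurable_pi_iff.2 fun p : (_ : ℕ) × Bool => hZ p.1 p.2)] at e2
    have e3 : ∀ i, P.map (fun ω b => Z i b ω) = Measure.infinitePi fun b => P.map (Z i b) := by
      intro i
      exact (hind.precomp (g := fun b : Bool => (⟨i, b⟩ : (_ : ℕ) × Bool))
        (fun b c hbc => by simpa using hbc)).map_fun_eq_infinitePi_map₀' (hZ i)
    simp_rw [e3]
    exact e2
  exact hpair.comp (fun _ f => f false - f true) (fun _ => by fun_prop)

end Walk

/-! ### Lindley's equation for the supremum of a random walk -/

lemma tendsto_atTop_of_tendsto_div {s : ℕ → ℝ} {m : ℝ} (hm : 0 < m)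
    (h : Tendsto (fun n : ℕ => s n / n) atTop (𝓝 m)) : Tendsto s atTop atTop := by
  have h2 := h.pos_mul_atTop hm tendsto_natCast_atTop_atTop
  refine h2.congr' ?_
  filter_upwards [eventually_gt_atTop 0] with n hn
  have : (n : ℝ) ≠ 0 := by positivity
  field_simp

section RandomWalk

variable {Ω : Type*} [MeasurableSpace Ω] {P : Measure Ω} {ξ : ℕ → Ω → ℝ} {κ : Measure ℝ}

lemma tendsto_sum_atTop (hind : iIndepFun ξ P) (hlaw : ∀ i, HasLaw (ξ i) κ P)
    (hint : Integrable (fun x : ℝ => x) κ) (hm : 0 < ∫ x, x ∂κ) :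
    ∀ᵐ ω ∂P, Tendsto (fun n => ∑ i ∈ Finset.range n, ξ i ω) atTop atTop := by
  have h1 : Integrable (ξ 0) P := by
    have h := hint
    rw [← (hlaw 0).map_eq, integrable_map_measure (by fun_prop) (hlaw 0).aemeasurable] at h
    exact h
  have h2 : P[ξ 0] = ∫ x, x ∂κ := (hlaw 0).integral_eq
  filter_upwards [strong_law_ae_real ξ h1 (fun i j hij => hind.indepFun hij)
    (fun i => (hlaw i).identDistrib (hlaw 0))] with ω hω
  exact tendsto_atTop_of_tendsto_div hm (h2 ▸ hω)

lemma walkSup_lt_top (hind : iIndepFun ξ P) (hlaw : ∀ i, HasLaw (ξ i) κ P)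
    (hint : Integrable (fun x : ℝ => x) κ) (hm : ∫ x, x ∂κ < 0) :
    ∀ᵐ ω ∂P, walkSup (fun i => ξ i ω) < ⊤ := by
  have hneg : ∀ i, HasLaw (fun ω => -ξ i ω) (κ.map fun x => -x) P := fun i =>
    (HasLaw.mk (by fun_prop) rfl : HasLaw (fun x : ℝ => -x) (κ.map fun x => -x) κ).fun_comp (hlaw i)
  have hint' : Integrable (fun x : ℝ => x) (κ.map fun x => -x) := by
    rw [integrable_map_measure (by fun_prop) (by fun_prop)]
    exact hint.neg
  have hm' : 0 < ∫ x, x ∂(κ.map fun x => -x) := by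
    rw [integral_map (by fun_prop) (by fun_prop), integral_neg]
    linarith
  have hind' : iIndepFun (fun i ω => -ξ i ω) P :=
    hind.comp (fun _ x => -x) (fun _ => measurable_neg)
  filter_upwards [tendsto_sum_atTop hind' hneg hint' hm'] with ω hω
  have hbot : Tendsto (fun n => ∑ i ∈ Finset.range n, ξ i ω) atTop atBot := by
    simpa using hω
  obtain ⟨b, hb⟩ := bddAbove_range_of_tendsto_atTop_atBot hbot
  refine lt_of_le_of_lt (iSup_le fun n => ?_) (EReal.coe_lt_top b)
  exact EReal.coe_le_coe_iff.2 (hb ⟨n, rfl⟩)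

lemma walkSup_eq_top (hind : iIndepFun ξ P) (hlaw : ∀ i, HasLaw (ξ i) κ P)
    (hint : Integrable (fun x : ℝ => x) κ) (hm : 0 < ∫ x, x ∂κ) :
    ∀ᵐ ω ∂P, walkSup (fun i => ξ i ω) = ⊤ := by
  filter_upwards [tendsto_sum_atTop hind hlaw hint hm] with ω hω
  rw [EReal.eq_top_iff_forall_lt]
  intro b
  obtain ⟨n, hn⟩ := (hω.eventually_gt_atTop b).exists
  exact (EReal.coe_lt_coe_iff.2 hn).trans_le
    (le_iSup (fun n : ℕ => ((∑ i ∈ Finset.range n, ξ i ω : ℝ) : EReal)) n)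

/-- **Lindley's equation.** The supremum after the first step is an independent copy of the
supremum, because the walk is stationary. -/
lemma lindley [IsProbabilityMeasure κ] (hind : iIndepFun ξ P) (hlaw : ∀ i, HasLaw (ξ i) κ P)
    (hfin : ∀ᵐ ω ∂P, walkSup (fun i => ξ i ω) < ⊤) {μ : Measure ℝ}
    (hμ : μ = P.map fun ω => (walkSup fun i => ξ i ω).toReal) :
    μ = (μ.prod κ).map fun p => max 0 (p.1 + p.2) := by
  let Q : Measure (ℕ → ℝ) := Measure.infinitePi fun _ => κ
  let S : (ℕ → ℝ) → ℕ → ℝ := fun x i => x (i + 1)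
  let V : (ℕ → ℝ) → ℝ := fun x => (walkSup x).toReal
  have hV : Measurable V := measurable_walkSup.ereal_toReal
  have hS : Measurable S := by fun_prop
  have hQ : HasLaw (fun ω i => ξ i ω) Q P :=
    hind.hasLaw_infinitePi hlaw (aemeasurable_pi_iff.2 fun i => (hlaw i).aemeasurable)
  have hμV : μ = Q.map V := by
    rw [hμ, ← hQ.map_eq, AEMeasurable.map_map_of_aemeasurable hV.aemeasurable hQ.aemeasurable]
    rfl
  have hQS : Q.map S = Q :=
    Measure.map_infinitePi_infinitePi_of_inj (P := fun _ : ℕ => κ) (add_left_injective 1)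
  have hfinQ : ∀ᵐ x ∂Q, walkSup (S x) < ⊤ := by
    have h1 : ∀ᵐ x ∂Q, walkSup x < ⊤ := by
      rw [← hQ.map_eq]
      exact (ae_map_iff hQ.aemeasurable (measurable_walkSup measurableSet_Iio)).2 hfin
    rw [← hQS] at h1
    exact ae_of_ae_map hS.aemeasurable h1
  have hcoord : iIndepFun (fun (i : ℕ) (x : ℕ → ℝ) => x i) Q :=
    iIndepFun_infinitePi (P := fun _ : ℕ => κ) (X := fun _ x => x) (fun _ => measurable_id)
  have hindS : IndepFun (fun x => V (S x)) (fun x : ℕ → ℝ => x 0) Q := by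
    have h1 : IndepFun S (fun x : ℕ → ℝ => x 0) Q := by
      have h2 := indep_iSup_of_disjoint (fun i => (measurable_pi_apply i).comap_le) hcoord.iIndep
        (show Disjoint (Set.range Nat.succ) {0} by simp)
      rw [IndepFun_iff_Indep]
      refine indep_of_indep_of_le_left (indep_of_indep_of_le_right h2 ?_) ?_
      · exact le_iSup₂_of_le 0 (by simp) le_rfl
      · rw [MeasurableSpace.pi, MeasurableSpace.comap_iSup]
        refine iSup_le fun i => ?_
        rw [MeasurableSpace.comap_comp]
        exact le_iSup₂_of_le (i + 1) ⟨i, rfl⟩ le_rfl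
    exact h1.comp hV measurable_id
  have hVS : Measurable fun x => (V (S x), x 0) := (hV.comp hS).prodMk (by fun_prop)
  have hprod : Q.map (fun x => (V (S x), x 0)) = μ.prod κ := by
    refine (hindS.map_prod_eq_prod_map_map (hV.comp hS).aemeasurable
      (measurable_pi_apply 0).aemeasurable).trans ?_
    congr 1
    · rw [hμV]
      nth_rw 2 [← hQS]
      exact (Measure.map_map hV hS).symm
    · exact Measure.infinitePi_map_eval (fun _ : ℕ => κ) 0
  rw [← hprod, Measure.map_map (by fun_prop) hVS, hμV]
  refine Measure.map_congr ?_
  filter_upwards [hfinQ] with x hx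
  exact toReal_walkSup_eq_max hx

end RandomWalk

/-! ### The exponential distribution -/

section Exponential

lemma integral_expMeasure {E : Type*} [NormedAddCommGroup E] [NormedSpace ℝ E] (lam : ℝ)
    (hlam : 0 < lam) (f : ℝ → E) :
    ∫ t, f t ∂expMeasure lam = ∫ t in Set.Ioi 0, (lam * Real.exp (-(lam * t))) • f t := by
  have h : expMeasure lam = volume.withDensity (exponentialPDF lam) := rfl
  have hm : Measurable (exponentialPDF lam) := (measurable_exponentialPDFReal lam).ennreal_ofReal
  rw [h, integral_withDensity_eq_integral_toReal_smul hm (by simp [exponentialPDF]),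
    ← integral_Ici_eq_integral_Ioi, ← integral_indicator measurableSet_Ici]
  congr 1
  ext t
  by_cases ht : 0 ≤ t
  · have : 0 ≤ lam * Real.exp (-(lam * t)) := by positivity
    simp [exponentialPDF_of_nonneg ht, ht, ENNReal.toReal_ofReal this]
  · simp [exponentialPDF_of_neg (not_le.1 ht), ht]

lemma ae_pos_expMeasure {lam : ℝ} (hlam : 0 < lam) : ∀ᵐ t ∂expMeasure lam, 0 < t := by
  have := isProbabilityMeasure_expMeasure hlam
  have h := cdf_expMeasure_eq hlam 0
  rw [cdf_eq_real] at h
  simp only [le_refl, if_true, mul_zero, neg_zero, Real.exp_zero, sub_self] at h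
  rw [ae_iff]
  simp only [not_lt]
  exact (measureReal_eq_zero_iff).1 h

lemma integral_id_expMeasure {lam : ℝ} (hlam : 0 < lam) :
    ∫ t, t ∂expMeasure lam = 1 / lam := by
  rw [integral_expMeasure lam hlam]
  have h := Real.integral_rpow_mul_exp_neg_mul_Ioi (a := 2) (r := lam) (by norm_num) hlam
  have h2 : ∀ t : ℝ, (lam * Real.exp (-(lam * t))) • t
      = lam * (t ^ ((2 : ℝ) - 1) * Real.exp (-(lam * t))) := by
    intro t
    norm_num
    ring
  simp_rw [h2]
  rw [integral_const_mul, h, Real.Gamma_two]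
  norm_num
  field_simp

lemma integrable_id_expMeasure {lam : ℝ} (hlam : 0 < lam) :
    Integrable (fun t : ℝ => t) (expMeasure lam) := by
  by_contra h
  have h1 := integral_id_expMeasure hlam
  rw [integral_undef h] at h1
  have : 0 < 1 / lam := by positivity
  linarith

open Complex in
/-- The transform of an exponential variable subtracted from `y` and truncated at zero. -/
lemma integral_exp_max_expMeasure {lam : ℝ} (hlam : 0 < lam) {y : ℝ} (hy : 0 ≤ y) (s : ℝ) :
    (∫ t, cexp (s * (max 0 (y - t) : ℝ) * I) ∂expMeasure lam) * (lam + s * I) =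
      s * I * cexp (-lam * y) + lam * cexp (s * y * I) := by
  have := isProbabilityMeasure_expMeasure hlam
  have hne : (lam + s * I : ℂ) ≠ 0 := by
    intro h
    have := congrArg Complex.re h
    simp at this
    exact hlam.ne' this
  have hint : Integrable (fun t => (lam * Real.exp (-(lam * t))) •
      cexp (s * (max 0 (y - t) : ℝ) * I)) (volume.restrict (Set.Ioi 0)) := by
    have h0 : Integrable (fun t => lam * Real.exp (-lam * t)) (volume.restrict (Set.Ioi 0)) :=
      (exp_neg_integrableOn_Ioi 0 hlam).const_mul lam
    refine (h0.ofReal (𝕜 := ℂ)).mono (by fun_prop) (ae_of_all _ fun t => ?_)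
    rw [norm_smul, show (s * (max 0 (y - t) : ℝ) * I : ℂ) = ((s * max 0 (y - t) : ℝ) : ℂ) * I by
      push_cast; ring, Complex.norm_exp_ofReal_mul_I]
    simp [Complex.norm_exp]
  rw [integral_expMeasure lam hlam, ← Set.Ioc_union_Ioi_eq_Ioi hy,
    setIntegral_union (Set.Ioc_disjoint_Ioi le_rfl) measurableSet_Ioi
      (hint.mono_measure (Measure.restrict_mono Set.Ioc_subset_Ioi_self le_rfl))
      (hint.mono_measure (Measure.restrict_mono (Set.Ioi_subset_Ioi hy) le_rfl))]
  have h1 : ∫ t in Set.Ioc 0 y, (lam * Real.exp (-(lam * t))) •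
      cexp (s * (max 0 (y - t) : ℝ) * I)
      = lam * cexp (s * y * I) * ((1 - cexp (-(lam + s * I) * y)) / (lam + s * I)) := by
    have : ∫ t in Set.Ioc 0 y, (lam * Real.exp (-(lam * t))) •
      cexp (s * (max 0 (y - t) : ℝ) * I)
      = ∫ t in Set.Ioc 0 y, lam * cexp (s * y * I) * cexp (-(lam + s * I) * t) := by
      refine setIntegral_congr_fun measurableSet_Ioc fun t ht => ?_
      simp only [max_eq_right (sub_nonneg.2 ht.2), real_smul]
      push_cast
      rw [mul_assoc (lam : ℂ), mul_assoc (lam : ℂ), ← Complex.exp_add, ← Complex.exp_add]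
      congr 2
      ring
    rw [this, ← intervalIntegral.integral_of_le hy, intervalIntegral.integral_const_mul,
      integral_exp_mul_complex (neg_ne_zero.2 hne)]
    simp only [ofReal_zero, mul_zero, Complex.exp_zero]
    rw [div_neg, ← neg_div, neg_sub]
  have h2 : ∫ t in Set.Ioi y, (lam * Real.exp (-(lam * t))) •
      cexp (s * (max 0 (y - t) : ℝ) * I) = cexp (-lam * y) := by
    have : ∫ t in Set.Ioi y, (lam * Real.exp (-(lam * t))) •
      cexp (s * (max 0 (y - t) : ℝ) * I) = ∫ t in Set.Ioi y, lam * cexp (-lam * t) := by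
      refine setIntegral_congr_fun measurableSet_Ioi fun t ht => ?_
      simp only [max_eq_left (sub_nonpos.2 (le_of_lt (Set.mem_Ioi.1 ht))), real_smul]
      simp
    rw [this, integral_const_mul, integral_exp_mul_complex_Ioi (by simpa using hlam)]
    have : (lam : ℂ) ≠ 0 := by exact_mod_cast hlam.ne'
    field_simp
  have h3 : cexp (-(lam + s * I) * y) * cexp (s * y * I) = cexp (-lam * y) := by
    rw [← Complex.exp_add]; ring_nf
  rw [h1, h2]
  rw [add_mul, mul_div_assoc', div_mul_cancel₀ _ hne]
  linear_combination (-lam : ℂ) * h3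

end Exponential

/-! ### The transform of Lindley's equation -/

section Transform

open Complex

lemma norm_cexp_real_mul_I (a b : ℝ) : ‖cexp (a * b * I)‖ = 1 := by
  rw [← ofReal_mul, Complex.norm_exp_ofReal_mul_I]

lemma integrable_cexp_mul_I {α : Type*} [MeasurableSpace α] (μ : Measure α) [IsFiniteMeasure μ]
    (s : ℝ) {f : α → ℝ} (hf : Measurable f) : Integrable (fun x => cexp (s * f x * I)) μ :=
  Integrable.of_bound (by fun_prop) 1 (ae_of_all _ fun x => (norm_cexp_real_mul_I s (f x)).le)

lemma integrable_cexp_id (μ : Measure ℝ) [IsFiniteMeasure μ] (s : ℝ) :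
    Integrable (fun x : ℝ => cexp (s * x * I)) μ :=
  integrable_cexp_mul_I μ s measurable_id

lemma integrable_cexp_neg {lam : ℝ} (hlam : 0 < lam) {F : Measure ℝ} [IsFiniteMeasure F]
    (hF : ∀ᵐ x ∂F, 0 ≤ x) : Integrable (fun x : ℝ => cexp (-lam * x)) F := by
  refine Integrable.of_bound (by fun_prop) 1 ?_
  filter_upwards [hF] with x hx
  rw [Complex.norm_exp]
  simpa using mul_nonneg hlam.le hx

/-- Transform of Lindley's equation when the negative part of the step is exponential. The unknown
constant `A` is the probability that the supremum vanishes. -/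
lemma exists_charFun_lindley {lam : ℝ} (hlam : 0 < lam) {μ G : Measure ℝ} [IsProbabilityMeasure μ]
    [IsProbabilityMeasure G] (hμ0 : ∀ᵐ x ∂μ, 0 ≤ x) (hG0 : ∀ᵐ x ∂G, 0 ≤ x)
    (hμ : μ = (μ.prod ((G.prod (expMeasure lam)).map fun p => p.1 - p.2)).map
      fun p => max 0 (p.1 + p.2)) :
    ∃ A : ℂ, ∀ s : ℝ,
      charFun μ s * (s * I - lam * (charFun G s - 1)) = s * I * A := by
  have := isProbabilityMeasure_expMeasure hlam
  have : IsProbabilityMeasure ((G.prod (expMeasure lam)).map fun p => p.1 - p.2) :=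
    Measure.isProbabilityMeasure_map (by fun_prop)
  refine ⟨(∫ m : ℝ, cexp (-lam * m) ∂μ) * ∫ x : ℝ, cexp (-lam * x) ∂G, fun s => ?_⟩
  have key : charFun μ s = ∫ m, ∫ x, ∫ t, cexp (s * (max 0 (m + x - t) : ℝ) * I)
      ∂expMeasure lam ∂G ∂μ := by
    conv_lhs => rw [hμ]
    rw [charFun_apply_real, integral_map (by fun_prop) (by fun_prop),
      integral_prod _ (integrable_cexp_mul_I _ s (by fun_prop))]
    refine integral_congr_ae (ae_of_all _ fun m => ?_)
    simp only
    rw [integral_map (by fun_prop) (by fun_prop),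
      integral_prod _ (integrable_cexp_mul_I _ s (by fun_prop))]
    simp only [add_sub_assoc]
  have key2 : charFun μ s * (lam + s * I) = ∫ m, ∫ x : ℝ, (s * I * cexp (-lam * m) *
      cexp (-lam * x) + lam * cexp (s * m * I) * cexp (s * x * I)) ∂G ∂μ := by
    rw [key, ← integral_mul_const]
    refine integral_congr_ae ?_
    filter_upwards [hμ0] with m hm
    rw [← integral_mul_const]
    refine integral_congr_ae ?_
    filter_upwards [hG0] with x hx
    rw [integral_exp_max_expMeasure hlam (add_nonneg hm hx)]
    push_cast
    rw [mul_assoc (s * I : ℂ), mul_assoc (lam : ℂ), ← Complex.exp_add, ← Complex.exp_add]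
    ring_nf
  have key3 : ∀ m : ℝ, ∫ x : ℝ, (s * I * cexp (-lam * m) *
      cexp (-lam * x) + lam * cexp (s * m * I) * cexp (s * x * I)) ∂G =
      s * I * (∫ x : ℝ, cexp (-lam * x) ∂G) * cexp (-lam * m) +
        lam * charFun G s * cexp (s * m * I) := by
    intro m
    rw [integral_add ((integrable_cexp_neg hlam hG0).const_mul _)
      ((integrable_cexp_id G s).const_mul _), integral_const_mul,
      integral_const_mul, charFun_apply_real]
    ring
  simp_rw [key3] at key2
  rw [integral_add ((integrable_cexp_neg hlam hμ0).const_mul _)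
      ((integrable_cexp_id μ s).const_mul _), integral_const_mul,
      integral_const_mul] at key2
  simp only [← charFun_apply_real] at key2
  linear_combination key2

lemma hasDerivAt_charFun_zero {G : Measure ℝ} [IsProbabilityMeasure G]
    (hG : Integrable (fun x : ℝ => x) G) :
    HasDerivAt (charFun G) (I * (∫ x, x ∂G : ℝ)) 0 := by
  have hm : MemLp id (1 : ℕ) G := by
    rw [Nat.cast_one, memLp_one_iff_integrable]; exact hG
  have h1 := iteratedDeriv_charFun_zero hm
  simp only [iteratedDeriv_one, pow_one] at h1
  rw [← h1]
  exact ((contDiff_charFun hm).differentiable (by simp)).differentiableAt.hasDerivAt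

/-- The constant is found by dividing by `s` and letting `s → 0`. -/
lemma charFun_lindley {lam : ℝ} (hlam : 0 < lam) {μ G : Measure ℝ} [IsProbabilityMeasure μ]
    [IsProbabilityMeasure G] (hμ0 : ∀ᵐ x ∂μ, 0 ≤ x) (hG0 : ∀ᵐ x ∂G, 0 ≤ x)
    (hG : Integrable (fun x : ℝ => x) G)
    (hμ : μ = (μ.prod ((G.prod (expMeasure lam)).map fun p => p.1 - p.2)).map
      fun p => max 0 (p.1 + p.2)) (s : ℝ) :
    charFun μ s * (s * I - lam * (charFun G s - 1)) = s * I * (1 - lam * (∫ x, x ∂G : ℝ)) := by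
  obtain ⟨A, hA⟩ := exists_charFun_lindley hlam hμ0 hG0 hμ
  have h1 := hasDerivAt_iff_tendsto_slope.1 (hasDerivAt_charFun_zero hG)
  have h2 : Tendsto (charFun μ) (𝓝[≠] 0) (𝓝 1) := by
    have h := (continuous_charFun (μ := μ)).tendsto 0
    rw [charFun_zero, probReal_univ] at h
    exact h.mono_left nhdsWithin_le_nhds
  have h3 := h2.mul ((h1.const_mul (lam : ℂ)).const_sub I)
  have h4 : Tendsto (fun s : ℝ => charFun μ s * (I - lam * slope (charFun G) 0 s)) (𝓝[≠] 0)
      (𝓝 (I * A)) := by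
    refine tendsto_const_nhds.congr' ?_
    filter_upwards [self_mem_nhdsWithin] with s hs
    have hs' : (s : ℂ) ≠ 0 := by exact_mod_cast hs
    rw [slope_def_module, sub_zero, charFun_zero, probReal_univ, real_smul]
    push_cast
    apply mul_left_cancel₀ hs'
    have := hA s
    field_simp
    linear_combination -this
  have h5 := tendsto_nhds_unique h3 h4
  have h6 : A = 1 - lam * (∫ x, x ∂G : ℝ) := by
    apply mul_left_cancel₀ I_ne_zero
    rw [← h5]
    ring
  rw [hA, h6]

end Transform

/-! ### The Pollaczek–Khinchine formula -/

section CramerLundberg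

variable {Ω : Type*} [MeasurableSpace Ω] {P : Measure Ω} {lam : ℝ} {G : Measure ℝ}
  {τ X : ℕ → Ω → ℝ}

/-- The law of a step of the random walk embedded at the claim epochs. -/
noncomputable def stepLaw (lam : ℝ) (G : Measure ℝ) : Measure ℝ :=
  (G.prod (expMeasure lam)).map fun p => p.1 - p.2

lemma integrable_id_stepLaw [IsProbabilityMeasure G] (hlam : 0 < lam)
    (hG : Integrable (fun x : ℝ => x) G) : Integrable (fun x : ℝ => x) (stepLaw lam G) := by
  have := isProbabilityMeasure_expMeasure hlam
  rw [stepLaw, integrable_map_measure (by fun_prop) (by fun_prop)]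
  exact (hG.comp_fst _).sub ((integrable_id_expMeasure hlam).comp_snd _)

lemma integral_id_stepLaw [IsProbabilityMeasure G] (hlam : 0 < lam)
    (hG : Integrable (fun x : ℝ => x) G) :
    ∫ x, x ∂stepLaw lam G = ∫ x, x ∂G - 1 / lam := by
  have := isProbabilityMeasure_expMeasure hlam
  rw [stepLaw, integral_map (by fun_prop) (by fun_prop),
    integral_sub (hG.comp_fst _) ((integrable_id_expMeasure hlam).comp_snd _),
    integral_fun_fst (fun x => x), integral_fun_snd (fun x => x), integral_id_expMeasure hlam]
  simp

namespace IsCramerLundberg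

variable (h : IsCramerLundberg P lam G τ X)
include h

lemma iIndepFun_step : iIndepFun (fun i ω => X i ω - τ i ω) P :=
  iIndepFun_sub h.indep (fun i => (h.law_interarrival i).aemeasurable)
    (fun i => (h.law_claim i).aemeasurable)

lemma hasLaw_step (hlam : 0 < lam) [IsProbabilityMeasure G] (i : ℕ) :
    HasLaw (fun ω => X i ω - τ i ω) (stepLaw lam G) P := by
  have := isProbabilityMeasure_expMeasure hlam
  have hP := h.indep.isProbabilityMeasure
  have hind : IndepFun (X i) (τ i) P :=
    h.indep.indepFun (i := Sum.inr i) (j := Sum.inl i) (by simp)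
  have hX := h.law_claim i
  have hτ := h.law_interarrival i
  refine ⟨hX.aemeasurable.sub hτ.aemeasurable, ?_⟩
  have h2 := hind.map_prod_eq_prod_map_map hX.aemeasurable hτ.aemeasurable
  rw [hX.map_eq, hτ.map_eq] at h2
  rw [stepLaw, ← h2, AEMeasurable.map_map_of_aemeasurable (by fun_prop)
    (hX.aemeasurable.prodMk hτ.aemeasurable)]
  rfl

lemma surplusSup_ae_eq (hlam : 0 < lam) :
    surplusSup τ X =ᵐ[P] fun ω => walkSup fun i => X i ω - τ i ω := by
  have := isProbabilityMeasure_expMeasure hlam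
  have hτ : iIndepFun τ P := h.indep.precomp (g := Sum.inl) Sum.inl_injective
  have hm : 0 < ∫ t, t ∂expMeasure lam := by
    rw [integral_id_expMeasure hlam]; positivity
  have hpos : ∀ᵐ ω ∂P, ∀ i, 0 < τ i ω := by
    rw [ae_all_iff]
    intro i
    have := ae_pos_expMeasure hlam
    rw [← (h.law_interarrival i).map_eq] at this
    exact ae_of_ae_map (h.law_interarrival i).aemeasurable this
  filter_upwards [hpos, tendsto_sum_atTop hτ h.law_interarrival (integrable_id_expMeasure hlam) hm]
    with ω h1 h2
  exact surplusSup_eq_walkSup h1 h2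

lemma aemeasurable_surplusSup (hlam : 0 < lam) : AEMeasurable (surplusSup τ X) P := by
  have h2 : AEMeasurable (fun ω i => X i ω - τ i ω) P := aemeasurable_pi_iff.2 fun i =>
    (h.law_claim i).aemeasurable.sub (h.law_interarrival i).aemeasurable
  exact (measurable_walkSup.comp_aemeasurable h2).congr (h.surplusSup_ae_eq hlam).symm

lemma surplusSup_nonneg (hlam : 0 < lam) : ∀ᵐ ω ∂P, 0 ≤ surplusSup τ X ω := by
  filter_upwards [h.surplusSup_ae_eq hlam] with ω h1
  rw [h1]
  exact walkSup_nonneg _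

variable [IsProbabilityMeasure G]

lemma surplusSup_lt_top (hlam : 0 < lam) (hG : Integrable (fun x : ℝ => x) G)
    (hρ : lam * ∫ x, x ∂G < 1) : ∀ᵐ ω ∂P, surplusSup τ X ω < ⊤ := by
  have hm : ∫ x, x ∂stepLaw lam G < 0 := by
    rw [integral_id_stepLaw hlam hG, sub_neg, lt_div_iff₀ hlam]
    linarith
  filter_upwards [h.surplusSup_ae_eq hlam, walkSup_lt_top h.iIndepFun_step (h.hasLaw_step hlam)
    (integrable_id_stepLaw hlam hG) hm] with ω h1 h2
  rwa [h1]

lemma surplusSup_eq_top (hlam : 0 < lam) (hG : Integrable (fun x : ℝ => x) G)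
    (hρ : 1 < lam * ∫ x, x ∂G) : ∀ᵐ ω ∂P, surplusSup τ X ω = ⊤ := by
  have hm : 0 < ∫ x, x ∂stepLaw lam G := by
    rw [integral_id_stepLaw hlam hG, sub_pos, div_lt_iff₀ hlam]
    linarith
  filter_upwards [h.surplusSup_ae_eq hlam, walkSup_eq_top h.iIndepFun_step (h.hasLaw_step hlam)
    (integrable_id_stepLaw hlam hG) hm] with ω h1 h2
  rwa [h1]

open Complex in
/-- **Pollaczek–Khinchine formula** for the characteristic function of the supremum of the claim
surplus process, with the denominator cleared. -/
lemma charFun_surplusSup (hlam : 0 < lam) (hG0 : ∀ᵐ x ∂G, 0 ≤ x)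
    (hG : Integrable (fun x : ℝ => x) G) (hρ : lam * ∫ x, x ∂G < 1) (s : ℝ) :
    charFun (P.map fun ω => (surplusSup τ X ω).toReal) s *
      (s * I - lam * (charFun G s - 1)) = s * I * (1 - lam * (∫ x, x ∂G : ℝ)) := by
  have := h.indep.isProbabilityMeasure
  have := isProbabilityMeasure_expMeasure hlam
  have hmeas : AEMeasurable (fun ω => (surplusSup τ X ω).toReal) P :=
    (h.aemeasurable_surplusSup hlam).ereal_toReal
  have : IsProbabilityMeasure (P.map fun ω => (surplusSup τ X ω).toReal) :=
    Measure.isProbabilityMeasure_map hmeas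
  have : IsProbabilityMeasure (stepLaw lam G) := Measure.isProbabilityMeasure_map (by fun_prop)
  refine charFun_lindley hlam ?_ hG0 hG ?_ s
  · refine (ae_map_iff hmeas measurableSet_Ici).2 ?_
    filter_upwards [h.surplusSup_nonneg hlam] with ω h1
    exact EReal.toReal_nonneg h1
  · refine lindley (κ := stepLaw lam G) h.iIndepFun_step (h.hasLaw_step hlam) ?_ ?_
    · filter_upwards [h.surplusSup_ae_eq hlam, h.surplusSup_lt_top hlam hG hρ] with ω h1 h2
      rwa [← h1]
    · refine Measure.map_congr ?_
      filter_upwards [h.surplusSup_ae_eq hlam] with ω h1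
      rw [h1]

end IsCramerLundberg

end CramerLundberg

/-! ### The stationary excess distribution -/

section Excess

open Complex

lemma integral_excessLaw {F : Measure ℝ} [IsFiniteMeasure F] (hm : 0 ≤ ∫ x, x ∂F) (f : ℝ → ℂ) :
    ∫ t, f t ∂excessLaw F =
      ∫ t in Set.Ioi 0, (F.real (Set.Ioi t) / ∫ x, x ∂F : ℝ) • f t := by
  have hanti : Antitone fun t => F.real (Set.Ioi t) := fun a b hab =>
    measureReal_mono (Set.Ioi_subset_Ioi hab)
  rw [excessLaw, integral_withDensity_eq_integral_toReal_smul
    (hanti.measurable.div_const _).ennreal_ofReal (by simp)]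
  refine integral_congr_ae (ae_of_all _ fun t => ?_)
  simp only
  rw [ENNReal.toReal_ofReal (div_nonneg measureReal_nonneg hm)]

lemma integral_tail_mul {F : Measure ℝ} [IsProbabilityMeasure F] (hF0 : ∀ᵐ x ∂F, 0 ≤ x)
    (hF : Integrable (fun x : ℝ => x) F) (s : ℝ) :
    ∫ t in Set.Ioi 0, F.real (Set.Ioi t) • (cexp (s * t * I) * (s * I)) = charFun F s - 1 := by
  let g : ℝ → ℂ := fun t => cexp (s * t * I) * (s * I)
  have hg : Continuous g := by fun_prop
  have hgn : ∀ t, ‖g t‖ = |s| := fun t => by simp [g, norm_cexp_real_mul_I]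
  let f : ℝ → ℝ → ℂ := fun t x => (Set.Ioi t).indicator (fun _ => g t) x
  have hf' : ∀ t x, f t x = (Set.Iio x).indicator g t := fun t x => by
    simp [f, Set.indicator_apply]
  have hmeas : Measurable (Function.uncurry f) := by
    have : Function.uncurry f = {p : ℝ × ℝ | p.1 < p.2}.indicator fun p => g p.1 := by
      ext p
      simp [f, Function.uncurry, Set.indicator_apply]
    rw [this]
    exact (hg.measurable.comp measurable_fst).indicator
      (measurableSet_lt measurable_fst measurable_snd)
  have hint : Integrable (Function.uncurry f) ((volume.restrict (Set.Ioi 0)).prod F) := by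
    rw [integrable_prod_iff' hmeas.aestronglyMeasurable]
    constructor
    · refine ae_of_all _ fun x => ?_
      simp only [Function.uncurry, hf']
      rw [integrable_indicator_iff measurableSet_Iio, IntegrableOn,
        Measure.restrict_restrict measurableSet_Iio, Set.Iio_inter_Ioi]
      exact (hg.integrableOn_Icc (a := 0) (b := x)).mono_set Set.Ioo_subset_Icc_self
    · refine (hF.const_mul |s|).congr ?_
      filter_upwards [hF0] with x hx
      simp only [Function.uncurry, hf', norm_indicator_eq_indicator_norm, hgn]
      rw [integral_indicator_const _ measurableSet_Iio, measureReal_restrict_apply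
        measurableSet_Iio, Set.Iio_inter_Ioi, Real.volume_real_Ioo_of_le hx]
      simp [mul_comm]
  have h1 : ∀ t, F.real (Set.Ioi t) • g t = ∫ x, f t x ∂F := fun t => by
    rw [integral_indicator_const _ measurableSet_Ioi]
  calc ∫ t in Set.Ioi 0, F.real (Set.Ioi t) • g t
      = ∫ t in Set.Ioi 0, ∫ x, f t x ∂F := by simp_rw [h1]
    _ = ∫ x, (∫ t in Set.Ioi 0, f t x) ∂F := integral_integral_swap hint
    _ = ∫ x : ℝ, (cexp (s * x * I) - 1) ∂F := by
        refine integral_congr_ae ?_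
        filter_upwards [hF0] with x hx
        simp_rw [hf']
        rw [integral_indicator measurableSet_Iio, Measure.restrict_restrict measurableSet_Iio,
          Set.Iio_inter_Ioi, ← integral_Ioc_eq_integral_Ioo, ← intervalIntegral.integral_of_le hx]
        have hd : ∀ t ∈ Set.uIcc 0 x, HasDerivAt (fun t : ℝ => cexp (s * t * I)) (g t) t := by
          intro t _
          have := ((((hasDerivAt_id (t : ℂ)).const_mul (s : ℂ)).mul_const I).cexp).comp_ofReal
          simpa [g] using this
        rw [intervalIntegral.integral_eq_sub_of_hasDerivAt hd (hg.intervalIntegrable _ _)]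
        simp
    _ = charFun F s - 1 := by
        rw [integral_sub (integrable_cexp_id F s) (integrable_const _), charFun_apply_real]
        simp

/-- The characteristic function of the stationary excess distribution. -/
lemma charFun_excessLaw {F : Measure ℝ} [IsProbabilityMeasure F] (hF0 : ∀ᵐ x ∂F, 0 ≤ x)
    (hF : Integrable (fun x : ℝ => x) F) (hm : ∫ x, x ∂F ≠ 0) (s : ℝ) :
    s * I * (∫ x, x ∂F : ℝ) * charFun (excessLaw F) s = charFun F s - 1 := by
  have hm' : ((∫ x, x ∂F : ℝ) : ℂ) ≠ 0 := by exact_mod_cast hm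
  rw [charFun_apply_real, integral_excessLaw (integral_nonneg_of_ae hF0),
    ← integral_tail_mul hF0 hF, ← integral_const_mul]
  refine integral_congr_ae (ae_of_all _ fun t => ?_)
  simp only [real_smul, ofReal_div]
  field_simp

lemma excessLaw_of_mean_eq_zero {F : Measure ℝ} (hm : ∫ x, x ∂F = 0) : excessLaw F = 0 := by
  simp [excessLaw, hm]

lemma ae_pos_excessLaw (F : Measure ℝ) : ∀ᵐ x ∂excessLaw F, 0 < x :=
  (withDensity_absolutelyContinuous _ _).ae_le (ae_restrict_mem measurableSet_Ioi)

end Excess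

/-! ### Series with terms `r ^ (n + 1) * (L (n + 1) - L n)` -/

section Series

/-- Summation by parts of a geometrically weighted series. -/
lemma hasSum_pow_mul_sub {r S : ℝ} {L : ℕ → ℝ}
    (h : HasSum (fun n => (1 - r) * r ^ n * L n) S) (hr : r ≠ 1) :
    HasSum (fun n => r ^ (n + 1) * (L (n + 1) - L n)) (S - L 0) := by
  have hr' : 1 - r ≠ 0 := sub_ne_zero.2 hr.symm
  have h1 : HasSum (fun n => r ^ n * L n) (S / (1 - r)) := by
    refine (h.div_const (1 - r)).congr_fun ?_
    intro n
    field_simp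
  have h2 : HasSum (fun n => r ^ (n + 1) * L (n + 1)) (S / (1 - r) - L 0) := by
    rw [hasSum_nat_add_iff' (f := fun n => r ^ n * L n) 1 |>.symm] at h1
    simpa using h1
  have h3 := h2.sub (h1.mul_left r)
  have e : S / (1 - r) - L 0 - r * (S / (1 - r)) = S - L 0 := by field_simp; ring
  rw [e] at h3
  refine h3.congr_fun ?_
  intro n
  ring

lemma mul_sub_le_sum_pow_mul_sub {r : ℝ} (hr : 1 ≤ r) {L : ℕ → ℝ} (hL : Monotone L) {m n : ℕ}
    (hmn : m ≤ n) :
    r * (L n - L m) ≤ ∑ k ∈ Finset.Ico m n, r ^ (k + 1) * (L (k + 1) - L k) := by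
  rw [← Finset.sum_Ico_sub L hmn, Finset.mul_sum]
  refine Finset.sum_le_sum fun k _ => ?_
  exact mul_le_mul_of_nonneg_right (le_self_pow₀ hr (by omega)) (sub_nonneg.2 (hL (by omega)))

/-- For `r > 1` the series overshoots: its sum is at least `r (1 - L 0 u)`. -/
lemma not_hasSum_of_one_lt {r : ℝ} (hr : 1 < r) {L : ℕ → ℝ → ℝ}
    (hmono : ∀ u, Monotone fun n => L n u) (hone : ∀ u, Tendsto (fun n => L n u) atTop (𝓝 1)) {u : ℝ}
    (hu : L 0 u < 1) :
    ¬ HasSum (fun n => r ^ (n + 1) * (L (n + 1) u - L n u)) (1 - L 0 u) := by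
  intro hs
  have h := le_of_tendsto_of_tendsto' (((hone u).sub_const (L 0 u)).const_mul r)
    hs.tendsto_sum_nat fun K => by
      have := mul_sub_le_sum_pow_mul_sub hr.le (hmono u) (Nat.zero_le K)
      rwa [Nat.Ico_zero_eq_range] at this
  nlinarith

/-- For `r ≥ 1` the tail of the series from `N` on dominates `1 - L N u`, which is close to `1` for
large `u`, so that the convergence is not uniform; for `r < 1` the series is dominated by a
geometric one. -/
lemma exists_tendstoUniformlyOn_iff {r : ℝ} (hr0 : 0 ≤ r) {L : ℕ → ℝ → ℝ}
    (hnonneg : ∀ n u, 0 ≤ L n u) (hle : ∀ n u, L n u ≤ 1) (hmono : ∀ u, Monotone fun n => L n u)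
    (hone : ∀ u, Tendsto (fun n => L n u) atTop (𝓝 1))
    (hzero : ∀ n, Tendsto (L n) atTop (𝓝 0)) :
    (∃ f : ℝ → ℝ, TendstoUniformlyOn
      (fun (K : ℕ) (u : ℝ) => ∑ n ∈ Finset.range K, r ^ (n + 1) * (L (n + 1) u - L n u))
      f atTop (Set.Ici 0)) ↔ r < 1 := by
  constructor
  · rintro ⟨f, hf⟩
    by_contra hge
    have hr1 : 1 ≤ r := not_lt.1 hge
    obtain ⟨N, hN⟩ := Metric.uniformCauchySeqOn_iff.1 hf.uniformCauchySeqOn (1 / 2) (by norm_num)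
    have h1 : ∀ u : ℝ, 0 ≤ u → 1 - L N u ≤ 1 / 2 := fun u hu => by
      refine le_of_tendsto ((hone u).sub_const _) ?_
      filter_upwards [eventually_ge_atTop N] with K hK
      have h2 := hN K hK N le_rfl u hu
      rw [Real.dist_eq, ← Finset.sum_Ico_eq_sub _ hK] at h2
      calc L K u - L N u ≤ r * (L K u - L N u) :=
            le_mul_of_one_le_left (sub_nonneg.2 (hmono u hK)) hr1
        _ ≤ _ := mul_sub_le_sum_pow_mul_sub hr1 (hmono u) hK
        _ ≤ _ := le_abs_self _
        _ ≤ 1 / 2 := h2.le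
    have h2 := le_of_tendsto ((hzero N).const_sub 1) ((eventually_ge_atTop 0).mono h1)
    norm_num at h2
  · intro hr1
    refine ⟨_, tendstoUniformlyOn_tsum_nat (u := fun n => r ^ (n + 1)) ?_ fun n u _ => ?_⟩
    · exact (summable_nat_add_iff 1).2 (summable_geometric_of_lt_one hr0 hr1)
    · have h3 : L n u ≤ L (n + 1) u := hmono u (Nat.le_succ n)
      rw [Real.norm_of_nonneg (mul_nonneg (by positivity) (sub_nonneg.2 h3))]
      exact mul_le_of_le_one_right (by positivity) (by linarith [hle (n + 1) u, hnonneg n u])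

end Series

/-! ### Mixtures of claim size distributions -/

section Mixture

variable {ε : ℝ} {F H : Measure ℝ}

lemma isProbabilityMeasure_mixtureLaw [IsProbabilityMeasure F] [IsProbabilityMeasure H]
    (h0 : 0 ≤ ε) (h1 : ε ≤ 1) : IsProbabilityMeasure (mixtureLaw ε F H) := by
  constructor
  simp [mixtureLaw, ← ENNReal.ofReal_add (sub_nonneg.2 h1) h0]

lemma integrable_mixtureLaw {E : Type*} [NormedAddCommGroup E] {f : ℝ → E}
    (hF : Integrable f F) (hH : Integrable f H) : Integrable f (mixtureLaw ε F H) :=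
  (hF.smul_measure ENNReal.ofReal_ne_top).add_measure (hH.smul_measure ENNReal.ofReal_ne_top)

lemma integral_mixtureLaw {E : Type*} [NormedAddCommGroup E] [NormedSpace ℝ E] (h0 : 0 ≤ ε)
    (h1 : ε ≤ 1) {f : ℝ → E} (hF : Integrable f F) (hH : Integrable f H) :
    ∫ x, f x ∂mixtureLaw ε F H = (1 - ε) • ∫ x, f x ∂F + ε • ∫ x, f x ∂H := by
  rw [mixtureLaw, integral_add_measure (hF.smul_measure ENNReal.ofReal_ne_top)
    (hH.smul_measure ENNReal.ofReal_ne_top), integral_smul_measure, integral_smul_measure,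
    ENNReal.toReal_ofReal (sub_nonneg.2 h1), ENNReal.toReal_ofReal h0]

lemma charFun_mixtureLaw [IsProbabilityMeasure F] [IsProbabilityMeasure H] (h0 : 0 ≤ ε)
    (h1 : ε ≤ 1) (s : ℝ) :
    charFun (mixtureLaw ε F H) s = (1 - ε) * charFun F s + ε * charFun H s := by
  simp only [charFun_apply_real]
  rw [integral_mixtureLaw h0 h1 (integrable_cexp_id F s) (integrable_cexp_id H s)]
  simp

lemma ae_mixtureLaw {p : ℝ → Prop} (hF : ∀ᵐ x ∂F, p x) (hH : ∀ᵐ x ∂H, p x) :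
    ∀ᵐ x ∂mixtureLaw ε F H, p x := by
  rw [mixtureLaw, ae_add_measure_iff]
  exact ⟨Measure.ae_smul_measure hF _, Measure.ae_smul_measure hH _⟩

end Mixture

/-! ### Tails of sums of independent variables -/

section Tail

open Complex

variable {Ω : Type*} [MeasurableSpace Ω] {P : Measure Ω} {m c : ℕ → Ω → ℝ} {μ ν : Measure ℝ}

/-- Real-valued version of the sum `M₀ + ⋯ + Mₙ + C₁ + ⋯ + Cₙ`. -/
def ladderSum (m c : ℕ → Ω → ℝ) (n : ℕ) (ω : Ω) : ℝ :=
  ∑ i ∈ Finset.range (n + 1), m i ω + ∑ i ∈ Finset.range n, c i ω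

lemma ladderSum_succ {Ω : Type*} {m c : ℕ → Ω → ℝ} (n : ℕ) (ω : Ω) :
    ladderSum m c (n + 1) ω = ladderSum m c n ω + (m (n + 1) ω + c n ω) := by
  simp only [ladderSum]
  rw [Finset.sum_range_succ _ (n + 1), Finset.sum_range_succ (fun i => c i ω) n]
  ring

lemma aemeasurable_ladderSum (hm : ∀ i, HasLaw (m i) μ P) (hc : ∀ i, HasLaw (c i) ν P) (n : ℕ) :
    AEMeasurable (ladderSum m c n) P := by
  have h1 := fun i => (hm i).aemeasurable
  have h2 := fun i => (hc i).aemeasurable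
  unfold ladderSum
  fun_prop

lemma charFun_ladderSum (hind : iIndepFun (Sum.elim m c) P) (hm : ∀ i, HasLaw (m i) μ P)
    (hc : ∀ i, HasLaw (c i) ν P) (n : ℕ) (s : ℝ) :
    charFun (P.map (ladderSum m c n)) s = charFun μ s ^ (n + 1) * charFun ν s ^ n := by
  have h1 : ladderSum m c n = fun ω => ∑ i ∈ (Finset.range (n + 1)).disjSum (Finset.range n),
      Sum.elim m c i ω := by
    ext ω
    rw [Finset.sum_disjSum]
    rfl
  have hmeas : ∀ i, AEMeasurable (Sum.elim m c i) P := by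
    rintro (i | i)
    · exact (hm i).aemeasurable
    · exact (hc i).aemeasurable
  rw [h1, iIndepFun.charFun_map_fun_finsetSum_eq_prod (fun i _ => hmeas i) (hind.restrict _),
    Finset.prod_disjSum]
  simp [(hm _).map_eq, (hc _).map_eq]

/-- A geometric mixture of the laws of the sums `M₀ + ⋯ + Mₙ + C₁ + ⋯ + Cₙ` is identified by its
characteristic function. -/
lemma hasSum_tail (hind : iIndepFun (Sum.elim m c) P) (hm : ∀ i, HasLaw (m i) μ P)
    (hc : ∀ i, HasLaw (c i) ν P) [IsProbabilityMeasure μ] [IsProbabilityMeasure ν] {r : ℝ}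
    (hr0 : 0 ≤ r) (hr1 : r < 1) {Λ : Measure ℝ} [IsProbabilityMeasure Λ]
    (hΛ : ∀ s, charFun Λ s * (1 - r * charFun μ s * charFun ν s) = (1 - r) * charFun μ s) (u : ℝ) :
    HasSum (fun n => (1 - r) * r ^ n * P.real {ω | u < ladderSum m c n ω})
      (Λ.real (Set.Ioi u)) := by
  have := hind.isProbabilityMeasure
  have hmeas := aemeasurable_ladderSum hm hc
  let w : ℕ → ℝ := fun n => (1 - r) * r ^ n
  have hw : ∀ n, 0 ≤ w n := fun n => mul_nonneg (by linarith) (by positivity)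
  have hws : HasSum w 1 := by
    have := (hasSum_geometric_of_lt_one hr0 hr1).mul_left (1 - r)
    rwa [mul_inv_cancel₀ (by linarith)] at this
  have hpr : ∀ n, IsProbabilityMeasure (P.map (ladderSum m c n)) := fun n =>
    Measure.isProbabilityMeasure_map (hmeas n)
  let Λ' : Measure ℝ := Measure.sum fun n => ENNReal.ofReal (w n) • P.map (ladderSum m c n)
  have hΛ' : IsProbabilityMeasure Λ' := by
    constructor
    simp only [Λ', Measure.sum_apply _ MeasurableSet.univ, Measure.smul_apply, measure_univ,
      smul_eq_mul, mul_one]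
    rw [← ENNReal.ofReal_tsum_of_nonneg hw hws.summable, hws.tsum_eq, ENNReal.ofReal_one]
  have hchar : ∀ s, HasSum (fun n => (w n : ℂ) * (charFun μ s ^ (n + 1) * charFun ν s ^ n))
      (charFun Λ' s) := by
    intro s
    have h := hasSum_integral_measure (integrable_cexp_id Λ' s)
    rw [← charFun_apply_real] at h
    refine h.congr_fun fun n => ?_
    rw [integral_smul_measure, ← charFun_apply_real, charFun_ladderSum hind hm hc,
      ENNReal.toReal_ofReal (hw n), real_smul]
  have heq : Λ' = Λ := by
    refine Measure.ext_of_charFun (funext fun s => ?_)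
    have hq : ‖(r : ℂ) * charFun μ s * charFun ν s‖ < 1 := by
      rw [norm_mul, norm_mul, norm_real, Real.norm_of_nonneg hr0]
      have h1 := norm_charFun_le_one (μ := μ) s
      have h2 := norm_charFun_le_one (μ := ν) s
      calc r * ‖charFun μ s‖ * ‖charFun ν s‖ ≤ r * 1 * 1 := by gcongr
        _ < 1 := by linarith
    have hne : 1 - (r : ℂ) * charFun μ s * charFun ν s ≠ 0 := by
      intro h0
      rw [← sub_eq_zero.1 h0] at hq
      simp at hq
    have h1 := (hasSum_geometric_of_norm_lt_one hq).mul_left ((1 - r) * charFun μ s)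
    have h2 : charFun Λ' s = (1 - r) * charFun μ s * (1 - r * charFun μ s * charFun ν s)⁻¹ := by
      refine (hchar s).unique (h1.congr_fun fun n => ?_)
      simp only [w]
      push_cast
      ring
    rw [h2, ← hΛ s, mul_assoc, mul_inv_cancel₀ hne, mul_one]
  rw [← heq]
  have h : ∀ n, (ENNReal.ofReal (w n) • P.map (ladderSum m c n)) (Set.Ioi u) =
      ENNReal.ofReal (w n * P.real {ω | u < ladderSum m c n ω}) := by
    intro n
    rw [Measure.smul_apply, smul_eq_mul, ENNReal.ofReal_mul (hw n), ofReal_measureReal,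
      Measure.map_apply_of_aemeasurable (hmeas n) measurableSet_Ioi]
    rfl
  have hnn : ∀ n, 0 ≤ w n * P.real {ω | u < ladderSum m c n ω} := fun n =>
    mul_nonneg (hw n) measureReal_nonneg
  have hsum : Summable fun n => w n * P.real {ω | u < ladderSum m c n ω} :=
    Summable.of_nonneg_of_le hnn
      (fun n => mul_le_of_le_one_right (hw n) measureReal_le_one) hws.summable
  have hval : Λ'.real (Set.Ioi u) = ∑' n, w n * P.real {ω | u < ladderSum m c n ω} := by
    rw [measureReal_def, Measure.sum_apply _ measurableSet_Ioi]
    simp_rw [h]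
    rw [← ENNReal.ofReal_tsum_of_nonneg hnn hsum, ENNReal.toReal_ofReal (tsum_nonneg hnn)]
  rw [hval]
  exact hsum.hasSum

lemma monotone_tail [IsFiniteMeasure P] (hm0 : ∀ᵐ ω ∂P, ∀ i, 0 ≤ m i ω)
    (hc0 : ∀ᵐ ω ∂P, ∀ i, 0 ≤ c i ω) (u : ℝ) :
    Monotone fun n => P.real {ω | u < ladderSum m c n ω} := by
  refine monotone_nat_of_le_succ fun n => ?_
  refine ENNReal.toReal_mono (measure_ne_top _ _) (measure_mono_ae ?_)
  filter_upwards [hm0, hc0] with ω h1 h2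
  intro (h : u < _)
  change u < _
  rw [ladderSum_succ]
  linarith [h1 (n + 1), h2 n]

/-- Chernoff's bound: a sum of `n` independent positive variables leaves every bounded set. -/
lemma tendsto_tail (hind : iIndepFun (Sum.elim m c) P)
    (hc : ∀ i, HasLaw (c i) ν P) (hm0 : ∀ᵐ ω ∂P, ∀ i, 0 ≤ m i ω) (hν : ∀ᵐ x ∂ν, 0 < x)
    (hc0 : ∀ᵐ ω ∂P, ∀ i, 0 ≤ c i ω) (u : ℝ) :
    Tendsto (fun n => P.real {ω | u < ladderSum m c n ω}) atTop (𝓝 1) := by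
  have := hind.isProbabilityMeasure
  have : IsProbabilityMeasure ν := (hc 0).isProbabilityMeasure_iff.1 inferInstance
  let q : ℝ := ∫ x, Real.exp (-1 * x) ∂ν
  have hint : Integrable (fun x : ℝ => Real.exp (-1 * x)) ν := by
    refine Integrable.of_bound (by fun_prop) 1 ?_
    filter_upwards [hν] with x hx
    simpa using hx.le
  have hq0 : 0 ≤ q := integral_nonneg fun x => (Real.exp_pos _).le
  have hq1 : q < 1 := by
    have hint1 : Integrable (fun x : ℝ => 1 - Real.exp (-1 * x)) ν := (integrable_const 1).sub hint
    have h1 : 0 < ∫ x, (1 - Real.exp (-1 * x)) ∂ν := by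
      rw [integral_pos_iff_support_of_nonneg_ae ?_ hint1]
      · have : ∀ᵐ x ∂ν, x ∈ Function.support fun x : ℝ => 1 - Real.exp (-1 * x) := by
          filter_upwards [hν] with x hx
          rw [Function.mem_support, sub_ne_zero]
          exact (show Real.exp (-1 * x) < 1 by simpa using hx).ne'
        rw [measure_eq_measure_of_null_sdiff (Set.subset_univ _) ?_, measure_univ]
        · exact one_pos
        · rw [← Set.compl_eq_univ_sdiff]; exact this
      · filter_upwards [hν] with x hx
        simpa using hx.le
    rw [integral_sub (integrable_const _) hint] at h1
    simp only [integral_const, probReal_univ, smul_eq_mul, mul_one] at h1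
    linarith
  have hcind : iIndepFun c P := hind.precomp (g := Sum.inr) Sum.inr_injective
  have hmgf : ∀ i, mgf (c i) P (-1) = q := fun i =>
    (hc i).integral_comp (f := fun x => Real.exp (-1 * x)) (by fun_prop)
  have hbound : ∀ n, 1 - Real.exp u * q ^ n ≤ P.real {ω | u < ladderSum m c n ω} := by
    intro n
    have hmn : AEMeasurable (∑ i ∈ Finset.range n, c i) P :=
      Finset.aemeasurable_sum _ fun i _ => (hc i).aemeasurable
    have hi : Integrable (fun ω => Real.exp (-1 * (∑ i ∈ Finset.range n, c i) ω)) P := by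
      refine Integrable.of_bound (by fun_prop) 1 ?_
      filter_upwards [hc0] with ω h
      simpa using Finset.sum_nonneg fun i _ => h i
    have h1 := measure_le_le_exp_mul_mgf u (by norm_num : (-1 : ℝ) ≤ 0) hi
    rw [hcind.mgf_sum₀ (fun i => (hc i).aemeasurable)] at h1
    simp only [hmgf, Finset.prod_const, Finset.card_range, neg_neg, one_mul] at h1
    have h2 : P.real {ω | u < (∑ i ∈ Finset.range n, c i) ω} =
        1 - P.real {ω | (∑ i ∈ Finset.range n, c i) ω ≤ u} := by
      rw [← probReal_compl_eq_one_sub₀ (nullMeasurableSet_le hmn aemeasurable_const)]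
      congr 1
      ext ω
      simp
    have h3 : P.real {ω | u < (∑ i ∈ Finset.range n, c i) ω} ≤
        P.real {ω | u < ladderSum m c n ω} := by
      refine ENNReal.toReal_mono (measure_ne_top _ _) (measure_mono_ae ?_)
      filter_upwards [hm0] with ω h
      intro (h' : u < _)
      change u < _
      rw [Finset.sum_apply] at h'
      have := Finset.sum_nonneg fun i (_ : i ∈ Finset.range (n + 1)) => h i
      rw [ladderSum]
      linarith
    linarith
  refine tendsto_of_tendsto_of_tendsto_of_le_of_le ?_ tendsto_const_nhds hbound
    (fun n => measureReal_le_one)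
  have := ((tendsto_pow_atTop_nhds_zero_of_lt_one hq0 hq1).const_mul (Real.exp u)).const_sub 1
  simpa using this

lemma tendsto_tail_atTop [IsProbabilityMeasure P] {R : Ω → ℝ} (hR : AEMeasurable R P) :
    Tendsto (fun u => P.real {ω | u < R ω}) atTop (𝓝 0) := by
  have : IsProbabilityMeasure (P.map R) := Measure.isProbabilityMeasure_map hR
  have h := (tendsto_cdf_atTop (P.map R)).const_sub 1
  rw [sub_self] at h
  refine h.congr fun u => ?_
  rw [cdf_eq_real, ← probReal_compl_eq_one_sub measurableSet_Iic, Set.compl_Iic, measureReal_def,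
    Measure.map_apply_of_aemeasurable hR measurableSet_Ioi]
  rfl

end Tail

/-! ### The discard expansion -/

section Discard

open Complex

variable {Ω : Type*} [MeasurableSpace Ω]

lemma ruinProb_eq {P : Measure Ω} {τ X : ℕ → Ω → ℝ}
    (hmeas : AEMeasurable (surplusSup τ X) P) (hfin : ∀ᵐ ω ∂P, surplusSup τ X ω < ⊤)
    (h0 : ∀ᵐ ω ∂P, 0 ≤ surplusSup τ X ω) (u : ℝ) :
    ruinProb P τ X u = (P.map fun ω => (surplusSup τ X ω).toReal).real (Set.Ioi u) := by
  rw [ruinProb, measureReal_def, measureReal_def,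
    Measure.map_apply_of_aemeasurable hmeas.ereal_toReal measurableSet_Ioi]
  congr 1
  refine measure_congr ?_
  filter_upwards [hfin, h0] with ω h1 h2
  change ((u : EReal) < _) = (u < _)
  rw [← EReal.coe_lt_coe_iff, EReal.coe_toReal h1.ne ((lt_of_lt_of_le (by simp) h2).ne')]

lemma coe_sum_ereal (s : Finset ℕ) (f : ℕ → ℝ) :
    ((∑ i ∈ s, f i : ℝ) : EReal) = ∑ i ∈ s, (f i : EReal) :=
  map_sum (⟨⟨((↑) : ℝ → EReal), EReal.coe_zero⟩, EReal.coe_add⟩ : ℝ →+ EReal) f s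

lemma tailL_eq {P : Measure Ω} {M : ℕ → Ω → EReal} {c : ℕ → Ω → ℝ}
    (hM : ∀ᵐ ω ∂P, ∀ i, ((M i ω).toReal : EReal) = M i ω) (n : ℕ) (u : ℝ) :
    tailL P M c n u = P.real {ω | u < ladderSum (fun i ω => (M i ω).toReal) c n ω} := by
  rw [tailL, measureReal_def, measureReal_def]
  congr 1
  refine measure_congr ?_
  filter_upwards [hM] with ω h
  change ((u : EReal) < _) = (u < _)
  rw [← EReal.coe_lt_coe_iff, ladderSum, EReal.coe_add]
  simp only [coe_sum_ereal, h]

/-- The algebra behind the expansion, with `z = i s`: `φ`, `φd` are the characteristic functions of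
the suprema in the mixture and in the discard model, `φB`, `φC` those of the claim sizes, with means
`b`, `c`, and `κ` that of the excess distribution. Eliminating `φB` from the two Pollaczek–Khinchine
formulas leaves a relation between `φ`, `φd` and `κ` alone. -/
lemma charFun_mixture_of_discard {lam ε δ θ r b c : ℝ} {φ φd φB φC κ z : ℂ} (hz : z ≠ 0)
    (hd : 1 - δ + ε * δ ≠ 0) (hδ : δ = lam * b) (hθ : θ = lam * c)
    (hr : r = ε * θ / (1 - δ + ε * δ))
    (hφ : φ * (z - lam * ((1 - ε) * φB + ε * φC - 1)) = z * (1 - lam * ((1 - ε) * b + ε * c)))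
    (hφd : φd * (z - lam * ((1 - ε) * φB + ε - 1)) = z * (1 - lam * ((1 - ε) * b)))
    (hκ : z * c * κ = φC - 1) :
    φ * (1 - r * φd * κ) = (1 - r) * φd := by
  have hrd : (r : ℂ) * (1 - δ + ε * δ) = ε * θ := by
    rw [hr]
    have : (1 - δ + ε * δ : ℂ) ≠ 0 := by exact_mod_cast hd
    push_cast
    field_simp
  have hδ' : (δ : ℂ) = lam * b := by exact_mod_cast hδ
  have hθ' : (θ : ℂ) = lam * c := by exact_mod_cast hθ
  have h1 : z * (1 - δ + ε * δ) ≠ 0 := mul_ne_zero hz (by exact_mod_cast hd)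
  have h2 : z - lam * ((1 - ε) * φB + ε - 1) ≠ 0 := by
    intro h
    rw [h, mul_zero] at hφd
    apply h1
    rw [hδ']
    linear_combination -hφd
  apply mul_right_cancel₀ h2
  rw [hδ', hθ'] at hrd
  linear_combination hφ + (-φ * r * κ - 1 + r) * hφd - (lam * ε * φ) * hκ
    + (-φ * κ * z + z) * hrd

end Discard

/-- The series has the expected sum as soon as both models are stable. -/
lemma hasSum_discardTerm {Ω₁ Ω₂ Ω₃ : Type*} [MeasurableSpace Ω₁] [MeasurableSpace Ω₂]
    [MeasurableSpace Ω₃] {P₁ : Measure Ω₁} {P₂ : Measure Ω₂} {P₃ : Measure Ω₃}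
    {lam ε δ θ r : ℝ} (hlam : 0 < lam) (hε0 : 0 ≤ ε) (hε1 : ε ≤ 1)
    {FB FC : Measure ℝ} [IsProbabilityMeasure FB] [IsProbabilityMeasure FC]
    (hB0 : ∀ᵐ x ∂FB, 0 ≤ x) (hC0 : ∀ᵐ x ∂FC, 0 ≤ x)
    (hBint : Integrable (fun x : ℝ => x) FB) (hCint : Integrable (fun x : ℝ => x) FC)
    (hδ : δ = lam * ∫ x, x ∂FB) (hθ : θ = lam * ∫ x, x ∂FC)
    (hρ : (1 - ε) * δ + ε * θ < 1)
    {τ X : ℕ → Ω₁ → ℝ} (hmix : IsCramerLundberg P₁ lam (mixtureLaw ε FB FC) τ X)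
    {τd Xd : ℕ → Ω₂ → ℝ} (hdis : IsCramerLundberg P₂ lam (discardLaw ε FB) τd Xd)
    {m c : ℕ → Ω₃ → ℝ} (hind : iIndepFun (Sum.elim m c) P₃)
    (hm : ∀ i, HasLaw (m i) (P₂.map fun ω => (surplusSup τd Xd ω).toReal) P₃)
    (hc : ∀ i, HasLaw (c i) (excessLaw FC) P₃)
    (hr : r = ε * θ / (1 - δ + ε * δ)) (u : ℝ) :
    HasSum (fun n => (1 - r) * r ^ n * P₃.real {ω | u < ladderSum m c n ω})
      (ruinProb P₁ τ X u) := by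
  have := hmix.indep.isProbabilityMeasure
  have := hdis.indep.isProbabilityMeasure
  have := hind.isProbabilityMeasure
  have hG : IsProbabilityMeasure (mixtureLaw ε FB FC) := isProbabilityMeasure_mixtureLaw hε0 hε1
  have hGd : IsProbabilityMeasure (discardLaw ε FB) := isProbabilityMeasure_mixtureLaw hε0 hε1
  have hν : IsProbabilityMeasure (excessLaw FC) :=
    (hc 0).isProbabilityMeasure_iff.1 inferInstance
  have hCmean : ∫ x, x ∂FC ≠ 0 := by
    intro h
    rw [excessLaw_of_mean_eq_zero h] at hν
    exact hν.ne_zero _ rfl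
  have hθ0 : 0 ≤ θ := hθ ▸ mul_nonneg hlam.le (integral_nonneg_of_ae hC0)
  have hεθ : 0 ≤ ε * θ := mul_nonneg hε0 hθ0
  have hd : 0 < 1 - δ + ε * δ := by linarith
  have hr0 : 0 ≤ r := hr ▸ div_nonneg hεθ hd.le
  have hr1 : r < 1 := by rw [hr, div_lt_one hd]; linarith
  have hdint : Integrable (fun x : ℝ => x) (Measure.dirac (0 : ℝ)) :=
    integrable_dirac (by simp)
  have hmeanmix := integral_mixtureLaw hε0 hε1 hBint hCint
  have hmeandis := integral_mixtureLaw hε0 hε1 hBint hdint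
  simp only [smul_eq_mul, integral_dirac, mul_zero, add_zero] at hmeanmix hmeandis
  have hρmix : lam * ∫ x, x ∂mixtureLaw ε FB FC < 1 := by
    rw [hmeanmix]
    calc _ = (1 - ε) * δ + ε * θ := by rw [hδ, hθ]; ring
      _ < 1 := hρ
  have hρdis : lam * ∫ x, x ∂discardLaw ε FB < 1 := by
    rw [discardLaw, hmeandis]
    calc _ = (1 - ε) * δ := by rw [hδ]; ring
      _ < 1 := by linarith
  have hmix_pk := hmix.charFun_surplusSup hlam (ae_mixtureLaw hB0 hC0)
    (integrable_mixtureLaw hBint hCint) hρmix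
  have hdis_pk := hdis.charFun_surplusSup hlam
    (ae_mixtureLaw hB0 (by simp [ae_dirac_eq])) (integrable_mixtureLaw hBint hdint) hρdis
  have hm1 := hmix.aemeasurable_surplusSup hlam
  have hpr1 : IsProbabilityMeasure (P₁.map fun ω => (surplusSup τ X ω).toReal) :=
    Measure.isProbabilityMeasure_map hm1.ereal_toReal
  have hpr2 : IsProbabilityMeasure (P₂.map fun ω => (surplusSup τd Xd ω).toReal) :=
    Measure.isProbabilityMeasure_map (hdis.aemeasurable_surplusSup hlam).ereal_toReal
  rw [ruinProb_eq hm1 (hmix.surplusSup_lt_top hlam (integrable_mixtureLaw hBint hCint) hρmix)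
    (hmix.surplusSup_nonneg hlam)]
  refine hasSum_tail hind hm hc hr0 hr1 (fun s => ?_) u
  rcases eq_or_ne s 0 with rfl | hs
  · simp [charFun_zero]
  · have hz : (s * Complex.I : ℂ) ≠ 0 := mul_ne_zero (by exact_mod_cast hs) Complex.I_ne_zero
    refine charFun_mixture_of_discard (φB := charFun FB s) hz hd.ne' hδ hθ hr
      ?_ ?_ (charFun_excessLaw hC0 hCint hCmean s)
    · have h := hmix_pk s
      rw [charFun_mixtureLaw hε0 hε1, hmeanmix] at h
      push_cast at h
      exact h
    · have h := hdis_pk s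
      rw [discardLaw, charFun_mixtureLaw hε0 hε1, hmeandis] at h
      simp only [charFun_dirac, inner_zero_left] at h
      push_cast at h
      simpa using h

theorem theoremt
    -- parameters and claim size distributions
    (lam ε δ θ : ℝ) (hlam : 0 < lam) (hε0 : 0 ≤ ε) (hε1 : ε ≤ 1)
    (FB FC : Measure ℝ) [IsProbabilityMeasure FB] [IsProbabilityMeasure FC]
    (hB : IsPhaseType FB) (hC : IsHeavyTailed FC)
    (hBint : Integrable (fun x : ℝ => x) FB) (hCint : Integrable (fun x : ℝ => x) FC)
    (hδ : δ = lam * ∫ x, x ∂FB) (hθ : θ = lam * ∫ x, x ∂FC)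
    -- net profit condition of the discard model
    (hbase : (1 - ε) * δ < 1)
    -- the mixture model
    {Ω₁ : Type*} [MeasurableSpace Ω₁] (P₁ : Measure Ω₁) [IsProbabilityMeasure P₁]
    (τ X : ℕ → Ω₁ → ℝ) (hmix : IsCramerLundberg P₁ lam (mixtureLaw ε FB FC) τ X)
    -- the discard model
    {Ω₂ : Type*} [MeasurableSpace Ω₂] (P₂ : Measure Ω₂) [IsProbabilityMeasure P₂]
    (τd Xd : ℕ → Ω₂ → ℝ) (hdis : IsCramerLundberg P₂ lam (discardLaw ε FB) τd Xd)
    -- independent copies of the discard supremum and of the heavy-tailed excess claims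
    {Ω₃ : Type*} [MeasurableSpace Ω₃] (P₃ : Measure Ω₃) [IsProbabilityMeasure P₃]
    (M : ℕ → Ω₃ → EReal) (Ce : ℕ → Ω₃ → ℝ)
    (hM : ∀ i, IdentDistrib (M i) (surplusSup τd Xd) P₃ P₂)
    (hCe : ∀ i, HasLaw (Ce i) (excessLaw FC) P₃)
    (hindep : iIndepFun (Sum.elim M (fun i ω => (Ce i ω : EReal))) P₃)
    (r : ℝ) (hr : r = ε * θ / (1 - δ + ε * δ)) :
    -- the leading term
    (∀ u : ℝ, 0 ≤ u → tailL P₃ M Ce 0 u = ruinProb P₂ τd Xd u) ∧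
    -- under the stability condition: the expansion and the criterion for its convergence
    ((1 - ε) * δ + ε * θ < 1 →
      (∀ u : ℝ, 0 ≤ u → HasSum (fun n => discardTerm P₃ M Ce r n u)
        (ruinProb P₁ τ X u - ruinProb P₂ τd Xd u)) ∧
      ((∀ u : ℝ, 0 ≤ u → Summable (fun n => discardTerm P₃ M Ce r n u)) ↔
        |ε * θ| < |1 - δ + ε * δ|)) ∧
    -- off criticality: the series converges to its intended value for all `u` iff …
    ((1 - ε) * δ + ε * θ ≠ 1 →
      ((∀ u : ℝ, 0 ≤ u → HasSum (fun n => discardTerm P₃ M Ce r n u)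
        (ruinProb P₁ τ X u - ruinProb P₂ τd Xd u)) ↔ |ε * θ| < |1 - δ + ε * δ|)) ∧
    -- without any stability condition on the mixture model: the series converges uniformly
    -- in the initial capital iff …
    ((∃ f : ℝ → ℝ, TendstoUniformlyOn
        (fun (K : ℕ) (u : ℝ) => ∑ n ∈ Finset.range K, discardTerm P₃ M Ce r n u)
        f atTop (Set.Ici 0)) ↔ |ε * θ| < |1 - δ + ε * δ|) := by
  have hB0 : ∀ᵐ x ∂FB, 0 ≤ x := by
    rw [ae_iff]
    simp only [not_le]
    exact hB.1
  have hC0 : ∀ᵐ x ∂FC, 0 ≤ x := by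
    rw [ae_iff]
    simp only [not_le]
    exact hC.1
  have hGd : IsProbabilityMeasure (discardLaw ε FB) := isProbabilityMeasure_mixtureLaw hε0 hε1
  have hG : IsProbabilityMeasure (mixtureLaw ε FB FC) := isProbabilityMeasure_mixtureLaw hε0 hε1
  have hθ0 : 0 ≤ θ := hθ ▸ mul_nonneg hlam.le (integral_nonneg_of_ae hC0)
  have hεθ : 0 ≤ ε * θ := mul_nonneg hε0 hθ0
  have hd : 0 < 1 - δ + ε * δ := by linarith
  have habs : |ε * θ| < |1 - δ + ε * δ| ↔ (1 - ε) * δ + ε * θ < 1 := by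
    rw [abs_of_nonneg hεθ, abs_of_pos hd]
    constructor <;> intro h <;> linarith
  have hr_lt : r < 1 ↔ (1 - ε) * δ + ε * θ < 1 := by
    rw [hr, div_lt_one hd]
    constructor <;> intro h <;> linarith
  have hr0 : 0 ≤ r := hr ▸ div_nonneg hεθ hd.le
  have hdint : Integrable (fun x : ℝ => x) (Measure.dirac (0 : ℝ)) := integrable_dirac (by simp)
  have hmeanmix := integral_mixtureLaw hε0 hε1 hBint hCint
  have hmeandis := integral_mixtureLaw hε0 hε1 hBint hdint
  simp only [smul_eq_mul, integral_dirac, mul_zero, add_zero] at hmeanmix hmeandis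
  have hρmix : lam * ∫ x, x ∂mixtureLaw ε FB FC = (1 - ε) * δ + ε * θ := by
    rw [hmeanmix, hδ, hθ]; ring
  have hρdis : lam * ∫ x, x ∂discardLaw ε FB < 1 := by
    rw [discardLaw, hmeandis]
    calc _ = (1 - ε) * δ := by rw [hδ]; ring
      _ < 1 := hbase
  -- the discard supremum is finite, so that its copies can be taken real-valued
  have hM0 : ∀ᵐ ω ∂P₃, ∀ i, 0 ≤ M i ω := ae_all_iff.2 fun i =>
    (hM i).symm.ae_snd (p := fun x => 0 ≤ x) measurableSet_Ici (hdis.surplusSup_nonneg hlam)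
  have hMtop : ∀ᵐ ω ∂P₃, ∀ i, M i ω < ⊤ := ae_all_iff.2 fun i =>
    (hM i).symm.ae_snd (p := fun x => x < ⊤) measurableSet_Iio
      (hdis.surplusSup_lt_top hlam (integrable_mixtureLaw hBint hdint) hρdis)
  have hMreal : ∀ᵐ ω ∂P₃, ∀ i, ((M i ω).toReal : EReal) = M i ω := by
    filter_upwards [hM0, hMtop] with ω h1 h2 i
    exact EReal.coe_toReal (h2 i).ne ((lt_of_lt_of_le (by simp) (h1 i)).ne')
  have hm0 : ∀ᵐ ω ∂P₃, ∀ i, 0 ≤ (M i ω).toReal := by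
    filter_upwards [hM0] with ω h i
    exact EReal.toReal_nonneg (h i)
  have hc0 : ∀ᵐ ω ∂P₃, ∀ i, 0 ≤ Ce i ω := ae_all_iff.2 fun i => by
    have h := ae_pos_excessLaw FC
    rw [← (hCe i).map_eq] at h
    filter_upwards [ae_of_ae_map (hCe i).aemeasurable h] with ω hω
    exact hω.le
  have hm : ∀ i, HasLaw (fun ω => (M i ω).toReal)
      (P₂.map fun ω => (surplusSup τd Xd ω).toReal) P₃ := fun i => by
    have h := (hM i).comp measurable_ereal_toReal
    exact ⟨h.aemeasurable_fst, h.map_eq⟩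
  have hind : iIndepFun (Sum.elim (fun i ω => (M i ω).toReal) Ce) P₃ := by
    have h := hindep.comp (fun _ => EReal.toReal) (fun _ => measurable_ereal_toReal)
    convert h using 2 with i
    rcases i with i | i
    · rfl
    · ext ω
      simp
  have hL : ∀ n u, tailL P₃ M Ce n u =
      P₃.real {ω | u < ladderSum (fun i ω => (M i ω).toReal) Ce n ω} := tailL_eq hMreal
  have hLmono : ∀ u, Monotone fun n => tailL P₃ M Ce n u := fun u => by
    simp_rw [hL]
    exact monotone_tail hm0 hc0 u
  have hLone : ∀ u, Tendsto (fun n => tailL P₃ M Ce n u) atTop (𝓝 1) := fun u => by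
    simp_rw [hL]
    exact tendsto_tail hind hCe hm0 (ae_pos_excessLaw FC) hc0 u
  have hLzero : ∀ n, Tendsto (fun u => tailL P₃ M Ce n u) atTop (𝓝 0) := fun n => by
    simp_rw [hL]
    exact tendsto_tail_atTop (aemeasurable_ladderSum hm hCe n)
  have hlead : ∀ u : ℝ, tailL P₃ M Ce 0 u = ruinProb P₂ τd Xd u := fun u => by
    have h := (hM 0).measure_mem_eq (s := Set.Ioi (u : EReal)) measurableSet_Ioi
    simp only [tailL, ruinProb, zero_add, Finset.range_one, Finset.sum_singleton,
      Finset.range_zero, Finset.sum_empty, add_zero, measureReal_def]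
    exact congrArg ENNReal.toReal h
  have hsum : (1 - ε) * δ + ε * θ < 1 → ∀ u : ℝ, HasSum (fun n => discardTerm P₃ M Ce r n u)
      (ruinProb P₁ τ X u - ruinProb P₂ τd Xd u) := fun hρ u => by
    have h := hasSum_discardTerm hlam hε0 hε1 hB0 hC0 hBint hCint hδ hθ hρ hmix hdis hind hm hCe
      hr u
    simp_rw [← hL] at h
    rw [← hlead]
    exact hasSum_pow_mul_sub (L := fun n => tailL P₃ M Ce n u) h (hr_lt.2 hρ).ne
  refine ⟨fun u _ => hlead u, fun hρ => ⟨fun u _ => hsum hρ u, ?_⟩, fun hρ => ⟨fun hs => ?_, ?_⟩,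
    (exists_tendstoUniformlyOn_iff (L := tailL P₃ M Ce) hr0 (fun _ _ => measureReal_nonneg)
      (fun _ _ => measureReal_le_one) hLmono hLone hLzero).trans (hr_lt.trans habs.symm)⟩
  · exact ⟨fun _ => habs.2 hρ, fun _ u _ => (hsum hρ u).summable⟩
  · rw [habs]
    by_contra hge
    have hgt : 1 < (1 - ε) * δ + ε * θ := lt_of_le_of_ne (not_lt.1 hge) hρ.symm
    have hr1 : 1 < r := by rw [hr, one_lt_div hd]; linarith
    -- for large `u` the discard model survives with positive probability
    obtain ⟨u, hu1, hu0⟩ := (((hLzero 0).eventually_lt_const one_pos).and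
      (eventually_ge_atTop 0)).exists
    have hruin : ruinProb P₁ τ X u = 1 := by
      have h : ∀ᵐ ω ∂P₁, (u : EReal) < surplusSup τ X ω := by
        filter_upwards [hmix.surplusSup_eq_top hlam (integrable_mixtureLaw hBint hCint)
          (hρmix ▸ hgt)] with ω h
        rw [h]
        exact EReal.coe_lt_top u
      rw [ruinProb, measureReal_def, measure_eq_measure_of_null_sdiff (Set.subset_univ _)
        (by rw [← Set.compl_eq_univ_sdiff]; exact h), measure_univ, ENNReal.toReal_one]
    have hs' := hs u hu0
    rw [hruin, ← hlead] at hs'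
    exact not_hasSum_of_one_lt (L := tailL P₃ M Ce) hr1 hLmono hLone hu1 hs'
  · exact fun h u _ => hsum (habs.1 h) u
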